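/- Let $n\ge 4$. A point of the geometric $D^{(1)}_n$-crystal $\mathcal B$ is $x=(x_1,\dots,x_n,\bar x_{n-1},\dots,\bar x_1)$ with nonzero real coordinates, and its level is $\ell(x)=x_1\cdots x_n\,\bar x_{n-1}\cdots\bar x_1$. For $0\le i\le n$ put $$\varepsilon_0(x)=x_1\Bigl(\tfrac{x_2}{\bar x_2}+1\Bigr),\quad \varepsilon_i(x)=\bar x_i\Bigl(\tfrac{x_{i+1}}{\bar x_{i+1}}+1\Bigr)\ (1\le i\le n-2),\quad \varepsilon_{n-1}(x)=x_n\bar x_{n-1},\quad \varepsilon_n(x)=\bar x_{n-1},$$ $$\varphi_0(x)=\bar x_1\Bigl(\tfrac{\bar x_2}{x_2}+1\Bigr),\quad \varphi_i(x)=x_i\Bigl(\tfrac{\bar x_{i+1}}{x_{i+1}}+1\Bigr)\ (1\le i\le n-2),\quad \varphi_{n-1}(x)=x_{n-1},\quad \varphi_n(x)=x_{n-1}x_n .$$ With $\xi_i=\frac{x_i+c\bar x_i}{x_i+\bar x_i}$, the transformation $e_i^c$ changes only the following coordinates of $x$: - $e_0^c$: $x_1\mapsto\xi_2^{-1}x_1$,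 $x_2\mapsto c^{-1}\xi_2x_2$, $\bar x_2\mapsto\xi_2\bar x_2$, $\bar x_1\mapsto c\,\xi_2^{-1}\bar x_1$; - $e_i^c$ ($1\le i\le n-2$): $x_i\mapsto c\,\xi_{i+1}^{-1}x_i$, $x_{i+1}\mapsto c^{-1}\xi_{i+1}x_{i+1}$, $\bar x_{i+1}\mapsto\xi_{i+1}\bar x_{i+1}$, $\bar x_i\mapsto\xi_{i+1}^{-1}\bar x_i$; - $e_{n-1}^c$: $x_{n-1}\mapsto c\,x_{n-1}$, $x_n\mapsto c^{-1}x_n$; - $e_n^c$: $x_n\mapsto c\,x_n$, $\bar x_{n-1}\mapsto c^{-1}\bar x_{n-1}$. On pairs, $e_i^c(x,y)=(e_i^{c_1}(x),e_i^{c_2}(y))$ with $$c_1=\frac{c\varphi_i(x)+\varepsilon_i(y)}{\varphi_i(x)+\varepsilon_i(y)},\qquad c_2=\frac{\varphi_i(x)+\varepsilon_i(y)}{\varphi_i(x)+c^{-1}\varepsilon_i(y)} .$$ We say that $e_i^c$ is defined at $(x,y)$ if $c\neq0$ and none of the denominators occurring in these formulas vanishes. Let $A(x)$ be the lower triangular $2n\times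 2n$ matrix with diagonal $\bigl(\tfrac{x_1}{\bar x_1},\dots,\tfrac{x_{n-1}}{\bar x_{n-1}},x_n,\tfrac1{x_n},\tfrac{\bar x_{n-1}}{x_{n-1}},\dots,\tfrac{\bar x_1}{x_1}\bigr)$ and with the following entries below the diagonal: $A_{n+1,n}=0$; for $1\le j<i\le n-1$, $$A_{i,j}=x_j\cdots x_{i-1}\Bigl(1+\tfrac{x_i}{\bar x_i}\Bigr),\qquad A_{2n+1-j,\,2n+1-i}=\bar x_j\cdots\bar x_{i-1}\Bigl(1+\tfrac{\bar x_i}{x_i}\Bigr);$$ for $1\le j\le n-1$, $$A_{n,j}=x_j\cdots x_n,\quad A_{n+1,j}=x_j\cdots x_{n-1},\quad A_{2n+1-j,n}=\bar x_j\cdots\bar x_{n-1}x_n,\quad A_{2n+1-j,n+1}=\bar x_j\cdots\bar x_{n-1};$$ and $A_{2n+1-i,j}=(x_j\cdots x_n)(\bar x_i\cdots\bar x_{n-1})$ for $1\le i,j\le n-1$. Let $C(x)=\ell(x)E_{1,2n}$, let $B(x)$ be the matrix with entries $$B(x)_{i,j}=A(x)_{i,1}A(x)_{2n,j}-\ell(x)A(x)_{i,j}-\ell(x)^{-1}C(x)_{i,j},$$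 and let $M(x,z)=A(x)+zB(x)+z^2C(x)$. The tropical $R$ sends $(x,y)$ to the (unique, where it exists) pair $(x',y')$ of points of $\mathcal B$ such that $$M(x,z)M(y,z)=M(x',z)M(y',z)\ \text{ for all } z,\qquad \ell(x)=\ell(y')\neq\ell(y)=\ell(x').$$ Put $V_0(x,y)=(A(x)A(y))_{2n,1}$. **Proposition.** Let $x,y$ be points of $\mathcal B$ and let $c$ be a real number. 1. If $1\le i\le n$ and $e_i^c$ is defined at $(x,y)$, then $V_0(e_i^c(x,y))=V_0(x,y)$. 2. If $e_0^c$ is defined at $(x,y)$, and $(x',y')=R(x,y)$ with $\varphi_0(x')+\varepsilon_0(y')\neq0$, then $$V_0(e_0^c(x,y))=V_0(x,y)\;\frac{c\,\varphi_0(x')+\varepsilon_0(y')}{\varphi_0(x')+\varepsilon_0(y')}\cdot\frac{c\,\varphi_0(x)+\varepsilon_0(y)}{c\,\varphi_0(x)+c\,\varepsilon_0(y)} .$$ -/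

import Mathlib

open Finset

noncomputable section

namespace GeomD

/-- A point `(x_1, …, x_n, x̄_{n-1}, …, x̄_1)` of the `(2n-1)`-dimensional coordinate space of the
geometric `D_n^{(1)}`-crystal. -/
@[ext]
structure Coord (n : ℕ) where
  plain : Fin n → ℝ
  barred : Fin (n - 1) → ℝ

variable {n : ℕ}

/-- The coordinate `x_i`, for `1 ≤ i ≤ n` (and `0` for an index out of range, never used). -/
def Coord.u (x : Coord n) (i : ℕ) : ℝ :=
  if h : i - 1 < n ∧ 1 ≤ i then x.plain ⟨i - 1, h.1⟩ else 0

/-- The coordinate `x̄_i`, for `1 ≤ i ≤ n - 1` (and `0` for an index out of range, never used). -/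
def Coord.ub (x : Coord n) (i : ℕ) : ℝ :=
  if h : i - 1 < n - 1 ∧ 1 ≤ i then x.barred ⟨i - 1, h.1⟩ else 0

/-- The point with `x_i = f i` and `x̄_i = g i`. -/
def Coord.ofFun (f g : ℕ → ℝ) : Coord n where
  plain := fun k => f (k + 1)
  barred := fun k => g (k + 1)

/-- All the coordinates are nonzero. -/
def Coord.Nonvanishing (x : Coord n) : Prop :=
  (∀ k, x.plain k ≠ 0) ∧ (∀ k, x.barred k ≠ 0)

/-- The level `ℓ(x) = x_1 ⋯ x_n x̄_{n-1} ⋯ x̄_1`. -/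
def level (x : Coord n) : ℝ :=
  (∏ k ∈ Icc 1 n, x.u k) * ∏ k ∈ Icc 1 (n - 1), x.ub k

/-- The function `ε_i`, for `0 ≤ i ≤ n`. -/
def eps (i : ℕ) (x : Coord n) : ℝ :=
  if i = 0 then x.u 1 * (x.u 2 / x.ub 2 + 1)
  else if i = n then x.ub (n - 1)
  else if i = n - 1 then x.u n * x.ub (n - 1)
  else x.ub i * (x.u (i + 1) / x.ub (i + 1) + 1)

/-- The function `φ_i`, for `0 ≤ i ≤ n`. -/
def phi (i : ℕ) (x : Coord n) : ℝ :=
  if i = 0 then x.ub 1 * (x.ub 2 / x.u 2 + 1)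
  else if i = n then x.u (n - 1) * x.u n
  else if i = n - 1 then x.u (n - 1)
  else x.u i * (x.ub (i + 1) / x.u (i + 1) + 1)

/-- `ξ_i = (x_i + c x̄_i) / (x_i + x̄_i)`. -/
def xi (i : ℕ) (c : ℝ) (x : Coord n) : ℝ :=
  (x.u i + c * x.ub i) / (x.u i + x.ub i)

/-- The transformation `e_i^c` of a single factor, for `0 ≤ i ≤ n`. -/
def e (i : ℕ) (c : ℝ) (x : Coord n) : Coord n :=
  if i = 0 then
    Coord.ofFun
      (fun k => if k = 1 then (xi 2 c x)⁻¹ * x.u 1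
        else if k = 2 then c⁻¹ * xi 2 c x * x.u 2 else x.u k)
      (fun k => if k = 1 then c * (xi 2 c x)⁻¹ * x.ub 1
        else if k = 2 then xi 2 c x * x.ub 2 else x.ub k)
  else if i = n then
    Coord.ofFun
      (fun k => if k = n then c * x.u n else x.u k)
      (fun k => if k = n - 1 then c⁻¹ * x.ub (n - 1) else x.ub k)
  else if i = n - 1 then
    Coord.ofFun
      (fun k => if k = n - 1 then c * x.u (n - 1)
        else if k = n then c⁻¹ * x.u n else x.u k)
      (fun k => x.ub k)
  else
    Coord.ofFun
      (fun k => if k = i then c * (xi (i + 1) c x)⁻¹ * x.u i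
        else if k = i + 1 then c⁻¹ * xi (i + 1) c x * x.u (i + 1) else x.u k)
      (fun k => if k = i then (xi (i + 1) c x)⁻¹ * x.ub i
        else if k = i + 1 then xi (i + 1) c x * x.ub (i + 1) else x.ub k)

/-- No denominator in the formula for `e_i^c (x)` vanishes: `c ≠ 0` and, for the indices `i` whose
formula involves `ξ_j` (`j = 2` if `i = 0`, and `j = i + 1` if `1 ≤ i ≤ n - 2`), the quotient `ξ_j`
is defined and nonzero. -/
def EDefined (i : ℕ) (c : ℝ) (x : Coord n) : Prop :=
  c ≠ 0 ∧
  (i = 0 → x.u 2 + x.ub 2 ≠ 0 ∧ x.u 2 + c * x.ub 2 ≠ 0) ∧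
  (1 ≤ i → i ≤ n - 2 →
    x.u (i + 1) + x.ub (i + 1) ≠ 0 ∧ x.u (i + 1) + c * x.ub (i + 1) ≠ 0)

/-- The parameter `c_1` with which `e_i^c (x, y)` acts on `x`. -/
def c1 (i : ℕ) (c : ℝ) (x y : Coord n) : ℝ :=
  (c * phi i x + eps i y) / (phi i x + eps i y)

/-- The parameter `c_2` with which `e_i^c (x, y)` acts on `y`. -/
def c2 (i : ℕ) (c : ℝ) (x y : Coord n) : ℝ :=
  (phi i x + eps i y) / (phi i x + c⁻¹ * eps i y)

/-- The transformation `e_i^c (x, y) = (e_i^{c_1} (x), e_i^{c_2} (y))` of the product crystal. -/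
def ePair (i : ℕ) (c : ℝ) (p : Coord n × Coord n) : Coord n × Coord n :=
  (e i (c1 i c p.1 p.2) p.1, e i (c2 i c p.1 p.2) p.2)

/-- No denominator in the formula for `e_i^c (x, y)` vanishes. -/
def EPairDefined (i : ℕ) (c : ℝ) (p : Coord n × Coord n) : Prop :=
  c ≠ 0 ∧ phi i p.1 + eps i p.2 ≠ 0 ∧ phi i p.1 + c⁻¹ * eps i p.2 ≠ 0 ∧
  EDefined i (c1 i c p.1 p.2) p.1 ∧ EDefined i (c2 i c p.1 p.2) p.2

/-- The entry `A(x)_{i,j}`, with rows and columns numbered `1, …, 2n`. In the rows `i ≥ n + 2` and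
the columns `j ≥ n + 2` we use the numbers `p = 2n + 1 - i` and `q = 2n + 1 - j`. -/
def entryA (x : Coord n) (i j : ℕ) : ℝ :=
  if i < j then 0
  else if i = j then
    if i ≤ n - 1 then x.u i / x.ub i
    else if i = n then x.u n
    else if i = n + 1 then 1 / x.u n
    else x.ub (2 * n + 1 - i) / x.u (2 * n + 1 - i)
  else if i ≤ n - 1 then (∏ k ∈ Ico j i, x.u k) * (1 + x.u i / x.ub i)
  else if i = n then ∏ k ∈ Icc j n, x.u k
  else if i = n + 1 then
    if j = n then 0 else ∏ k ∈ Icc j (n - 1), x.u k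
  else
    let p := 2 * n + 1 - i
    if j ≤ n - 1 then (∏ k ∈ Icc j n, x.u k) * ∏ k ∈ Icc p (n - 1), x.ub k
    else if j = n then (∏ k ∈ Icc p (n - 1), x.ub k) * x.u n
    else if j = n + 1 then ∏ k ∈ Icc p (n - 1), x.ub k
    else
      let q := 2 * n + 1 - j
      (∏ k ∈ Ico p q, x.ub k) * (1 + x.ub q / x.u q)

/-- The lower triangular `2n × 2n` matrix `A(x)`. -/
def matA (x : Coord n) : Matrix (Fin (2 * n)) (Fin (2 * n)) ℝ :=
  Matrix.of fun i j => entryA x (i + 1) (j + 1)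

/-- The matrix `C(x) = ℓ(x) E_{1,2n}`. -/
def matC (x : Coord n) : Matrix (Fin (2 * n)) (Fin (2 * n)) ℝ :=
  Matrix.of fun i j => if (i : ℕ) + 1 = 1 ∧ (j : ℕ) + 1 = 2 * n then level x else 0

/-- The matrix `B(x) = D₂(x) P D₁(x) - ℓ(x) A(x) - ℓ(x)⁻¹ C(x)`, where `P` is the matrix all of whose
entries are `1`, and `D₂(x)`, `D₁(x)` are the diagonal matrices made of the first column and of the
last row of `A(x)`. -/
def matB (x : Coord n) : Matrix (Fin (2 * n)) (Fin (2 * n)) ℝ :=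
  Matrix.diagonal (fun i : Fin (2 * n) => entryA x (i + 1) 1) *
      Matrix.of (fun _ _ => (1 : ℝ)) *
      Matrix.diagonal (fun j : Fin (2 * n) => entryA x (2 * n) (j + 1))
    - level x • matA x - (level x)⁻¹ • matC x

/-- The matrix `M(x,z) = A(x) + z B(x) + z² C(x)`. -/
def matM (x : Coord n) (z : ℝ) : Matrix (Fin (2 * n)) (Fin (2 * n)) ℝ :=
  matA x + z • matB x + z ^ 2 • matC x

/-- The graph of the tropical `R`: `R(x, y) = (x', y')`, that is, `(x', y')` is the (unique)
solution of `M(x,z) M(y,z) = M(x',z) M(y',z)` (for all `z`) under the constraints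
`ℓ(x) = ℓ(y') ≠ ℓ(y) = ℓ(x')`. -/
structure IsTropicalR (p q : Coord n × Coord n) : Prop where
  nonvanishing₁ : q.1.Nonvanishing
  nonvanishing₂ : q.2.Nonvanishing
  level_eq₁ : level p.1 = level q.2
  level_ne : level q.2 ≠ level p.2
  level_eq₂ : level p.2 = level q.1
  matM_mul : ∀ z : ℝ, matM p.1 z * matM p.2 z = matM q.1 z * matM q.2 z

/-- `V_0 (x, y) = (A(x) A(y))_{2n,1}`. -/
def V0 (hn : 4 ≤ n) (p : Coord n × Coord n) : ℝ :=
  (matA p.1 * matA p.2) ⟨2 * n - 1, by omega⟩ ⟨0, by omega⟩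

end GeomD

end

namespace GeomD

variable {n : ℕ}

/-! Expanding the matrix product writes $V_0$ as an explicit polynomial expression in coordinates
and ratios, `cornerSum`, and the theorem becomes a study of how $e_i^c$ acts on it.

For $1\le i\le n-2$, $e_i^c$ preserves the products $x_ix_{i+1}$, $\bar x_i\bar x_{i+1}$ and their
analogues for $y$. Hence only the summands of index $i$ and $i+1$ can change, and the values of
$c_1,c_2$ make each pair keep its total (`middle_identity_left`, `middle_identity_right`). For
$i=n-1,n$ the moving coordinates enter only through two invariant products and one bracket
(`cornerSum_succ`), and that bracket is invariant as well.

For $i=0$, isolating the indices $1,2$ gives, with $\varphi=\varphi_0(x)$,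
$\varepsilon=\varepsilon_0(y)$ and $G=\varphi\,y_1/\bar y_1+(\bar x_1/x_1)\varepsilon$,
$V_0(e_0^c(x,y))=c_2^{-1}\bigl(c_1V_0+(c-1)(\ell(y)-\ell(x))G/(\varphi+\varepsilon)\bigr)$
(`V0_ePair_zero`). The matrix equation defining $R$ eliminates $G$: three entries of its
coefficients of $z^0$ and $z^1$ yield
$V_0\,\varphi_0(x')(\varphi+\varepsilon)=(\varphi_0(x')+\varepsilon_0(y'))\bigl(V_0\varphi+(\ell(y)-\ell(x))G\bigr)$
(`IsTropicalR.V0_mul_phi_zero`), and the formula follows. -/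

/-! ### Products and sums that change at two indices only. -/

theorem prod_eq_prod_of_pair {s : Finset ℕ} {f g : ℕ → ℝ} {i j : ℕ} (hij : i ≠ j)
    (hi : i ∈ s) (hj : j ∈ s) (h : f i * f j = g i * g j)
    (hfg : ∀ k ∈ s, k ≠ i → k ≠ j → f k = g k) : ∏ k ∈ s, f k = ∏ k ∈ s, g k := by
  have hj' : j ∈ s.erase i := mem_erase.2 ⟨hij.symm, hj⟩
  rw [← mul_prod_erase s f hi, ← mul_prod_erase s g hi, ← mul_prod_erase _ f hj',
    ← mul_prod_erase _ g hj', ← mul_assoc, ← mul_assoc, h]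
  congr 1
  refine prod_congr rfl fun k hk => ?_
  simp only [mem_erase] at hk
  exact hfg k hk.2.2 hk.2.1 hk.1

theorem sum_eq_sum_of_pair {s : Finset ℕ} {f g : ℕ → ℝ} {i j : ℕ} (hij : i ≠ j)
    (hi : i ∈ s) (hj : j ∈ s) (h : f i + f j = g i + g j)
    (hfg : ∀ k ∈ s, k ≠ i → k ≠ j → f k = g k) : ∑ k ∈ s, f k = ∑ k ∈ s, g k := by
  have hj' : j ∈ s.erase i := mem_erase.2 ⟨hij.symm, hj⟩
  rw [← add_sum_erase s f hi, ← add_sum_erase s g hi, ← add_sum_erase _ f hj',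
    ← add_sum_erase _ g hj', ← add_assoc, ← add_assoc, h]
  congr 1
  refine sum_congr rfl fun k hk => ?_
  simp only [mem_erase] at hk
  exact hfg k hk.2.2 hk.2.1 hk.1

/-- A product over an interval containing both or neither of `i`, `i + 1` only depends on the
product of the factors at `i` and `i + 1`. -/
theorem prod_Ico_eq_of_pair {f g : ℕ → ℝ} {i : ℕ} (h : f i * f (i + 1) = g i * g (i + 1))
    (hfg : ∀ k, k ≠ i → k ≠ i + 1 → f k = g k) {a b : ℕ} (ha : a ≠ i + 1) (hb : b ≠ i + 1) :
    ∏ k ∈ Ico a b, f k = ∏ k ∈ Ico a b, g k := by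
  by_cases hi : i ∈ Ico a b
  · have hi' : i + 1 ∈ Ico a b := by simp only [mem_Ico] at hi ⊢; omega
    exact prod_eq_prod_of_pair (by omega) hi hi' h fun k _ => hfg k
  · refine prod_congr rfl fun k hk => hfg k ?_ ?_ <;>
    · rintro rfl; simp only [mem_Ico] at hi hk; omega

/-! ### The explicit form of the corner entry and its dependence on few coordinates. -/

/-- The entry `(A(x) A(y))_{2n,1}` as a function of the coordinates `u`, `ub` of `x` and
`v`, `vb` of `y`. -/
noncomputable def cornerSum (n : ℕ) (u ub v vb : ℕ → ℝ) : ℝ :=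
  (∑ k ∈ Ico 1 n, (∏ j ∈ Ico k (n + 1), u j) * (∏ j ∈ Ico 1 n, ub j) * (∏ j ∈ Ico 1 k, v j) *
      (1 + v k / vb k))
    + (∑ k ∈ Ico 1 n, (∏ j ∈ Ico 1 k, ub j) * (1 + ub k / u k) * (∏ j ∈ Ico 1 (n + 1), v j) *
      ∏ j ∈ Ico k n, vb j)
    + (∏ j ∈ Ico 1 n, ub j) * (u n * (∏ j ∈ Ico 1 (n + 1), v j) + ∏ j ∈ Ico 1 n, v j)
    - (∏ j ∈ Ico 1 (n + 1), u j) * (∏ j ∈ Ico 1 n, ub j)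
    - (∏ j ∈ Ico 1 (n + 1), v j) * (∏ j ∈ Ico 1 n, vb j)

theorem cornerSum_eq_of_middle {i : ℕ} (hi : 1 ≤ i) (hin : i + 1 < n)
    {u ub v vb u' ub' v' vb' : ℕ → ℝ}
    (hu : ∀ k, k ≠ i → k ≠ i + 1 → u k = u' k) (hub : ∀ k, k ≠ i → k ≠ i + 1 → ub k = ub' k)
    (hv : ∀ k, k ≠ i → k ≠ i + 1 → v k = v' k) (hvb : ∀ k, k ≠ i → k ≠ i + 1 → vb k = vb' k)
    (pu : u i * u (i + 1) = u' i * u' (i + 1)) (pub : ub i * ub (i + 1) = ub' i * ub' (i + 1))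
    (pv : v i * v (i + 1) = v' i * v' (i + 1)) (pvb : vb i * vb (i + 1) = vb' i * vb' (i + 1))
    (h₁ : u i * u (i + 1) * (1 + v i / vb i) + u (i + 1) * v i * (1 + v (i + 1) / vb (i + 1)) =
      u' i * u' (i + 1) * (1 + v' i / vb' i)
        + u' (i + 1) * v' i * (1 + v' (i + 1) / vb' (i + 1)))
    (h₂ : (1 + ub i / u i) * (vb i * vb (i + 1)) + ub i * (1 + ub (i + 1) / u (i + 1)) * vb (i + 1)
      = (1 + ub' i / u' i) * (vb' i * vb' (i + 1))
        + ub' i * (1 + ub' (i + 1) / u' (i + 1)) * vb' (i + 1)) :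
    cornerSum n u ub v vb = cornerSum n u' ub' v' vb' := by
  have Pu : ∀ a b, a ≠ i + 1 → b ≠ i + 1 → ∏ k ∈ Ico a b, u k = ∏ k ∈ Ico a b, u' k :=
    fun a b => prod_Ico_eq_of_pair pu hu
  have Pub : ∀ a b, a ≠ i + 1 → b ≠ i + 1 → ∏ k ∈ Ico a b, ub k = ∏ k ∈ Ico a b, ub' k :=
    fun a b => prod_Ico_eq_of_pair pub hub
  have Pv : ∀ a b, a ≠ i + 1 → b ≠ i + 1 → ∏ k ∈ Ico a b, v k = ∏ k ∈ Ico a b, v' k :=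
    fun a b => prod_Ico_eq_of_pair pv hv
  have Pvb : ∀ a b, a ≠ i + 1 → b ≠ i + 1 → ∏ k ∈ Ico a b, vb k = ∏ k ∈ Ico a b, vb' k :=
    fun a b => prod_Ico_eq_of_pair pvb hvb
  have mi : i ∈ Ico 1 n := by simp only [mem_Ico]; omega
  have mi' : i + 1 ∈ Ico 1 n := by simp only [mem_Ico]; omega
  have split_bot : ∀ (f : ℕ → ℝ) (b : ℕ), i + 1 < b →
      ∏ k ∈ Ico i b, f k = f i * (f (i + 1) * ∏ k ∈ Ico (i + 2) b, f k) ∧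
      ∏ k ∈ Ico (i + 1) b, f k = f (i + 1) * ∏ k ∈ Ico (i + 2) b, f k := fun f b hb => by
    rw [prod_eq_prod_Ico_succ_bot (by omega) f, prod_eq_prod_Ico_succ_bot hb f]
    exact ⟨rfl, rfl⟩
  unfold cornerSum
  rw [Pu 1 (n + 1) (by omega) (by omega), Pub 1 n (by omega) (by omega),
    Pv 1 (n + 1) (by omega) (by omega), Pv 1 n (by omega) (by omega),
    Pvb 1 n (by omega) (by omega), hu n (by omega) (by omega)]
  congr 4
  -- An interval product ending or starting between $i$ and $i+1$ occurs only in the summands of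
  -- index $i$ and $i+1$; `h₁` is their total with the common factors removed.
  · refine sum_eq_sum_of_pair (i := i) (j := i + 1) (by omega) mi mi' ?_ fun k hk h h' => ?_
    · rw [(split_bot u (n + 1) (by omega)).1, (split_bot u (n + 1) (by omega)).2,
        (split_bot u' (n + 1) (by omega)).1, (split_bot u' (n + 1) (by omega)).2,
        prod_Ico_succ_top hi, prod_Ico_succ_top hi, Pv 1 i (by omega) (by omega),
        Pu (i + 2) (n + 1) (by omega) (by omega)]
      linear_combination (∏ k ∈ Ico (i + 2) (n + 1), u' k) * (∏ k ∈ Ico 1 n, ub' k) *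
        (∏ k ∈ Ico 1 i, v' k) * h₁
    · rw [Pu k (n + 1) h' (by omega), Pv 1 k (by omega) h', hv k h h', hvb k h h']
  · refine sum_eq_sum_of_pair (i := i) (j := i + 1) (by omega) mi mi' ?_ fun k hk h h' => ?_
    · rw [(split_bot vb n (by omega)).1, (split_bot vb n (by omega)).2,
        (split_bot vb' n (by omega)).1, (split_bot vb' n (by omega)).2,
        prod_Ico_succ_top hi, prod_Ico_succ_top hi, Pub 1 i (by omega) (by omega),
        Pvb (i + 2) n (by omega) (by omega)]
      linear_combination (∏ k ∈ Ico (i + 2) n, vb' k) * (∏ k ∈ Ico 1 (n + 1), v' k) *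
        (∏ k ∈ Ico 1 i, ub' k) * h₂
    · rw [Pub 1 k (by omega) h', Pvb k n h' (by omega), hu k h h', hub k h h']

/-- Isolation of the coordinates `x_{n-1}`, `x_n`, `x̄_{n-1}` in `cornerSum`. -/
theorem cornerSum_succ {m : ℕ} (hm : 1 ≤ m) (u ub v vb : ℕ → ℝ) :
    cornerSum (m + 1) u ub v vb =
      u m * u (m + 1) * ub m * (∑ k ∈ Ico 1 m, (∏ j ∈ Ico k m, u j) * (∏ j ∈ Ico 1 m, ub j) *
        (∏ j ∈ Ico 1 k, v j) * (1 + v k / vb k))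
      + v m * v (m + 1) * vb m * (∑ k ∈ Ico 1 m, (∏ j ∈ Ico 1 k, ub j) * (1 + ub k / u k) *
        (∏ j ∈ Ico 1 m, v j) * ∏ j ∈ Ico k m, vb j)
      + (∏ j ∈ Ico 1 m, ub j) * (∏ j ∈ Ico 1 m, v j) *
        (u m * u (m + 1) * ub m * (1 + v m / vb m)
          + (1 + ub m / u m) * (v m * v (m + 1) * vb m)
          + ub m * (u (m + 1) * (v m * v (m + 1)) + v m))
      - u m * u (m + 1) * ub m * ((∏ j ∈ Ico 1 m, u j) * (∏ j ∈ Ico 1 m, ub j))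
      - v m * v (m + 1) * vb m * ((∏ j ∈ Ico 1 m, v j) * (∏ j ∈ Ico 1 m, vb j)) := by
  have top : ∀ (f : ℕ → ℝ) (a : ℕ), a ≤ m →
      ∏ k ∈ Ico a (m + 1), f k = (∏ k ∈ Ico a m, f k) * f m := fun f a ha =>
    prod_Ico_succ_top ha f
  have top' : ∀ (f : ℕ → ℝ) (a : ℕ), a ≤ m →
      ∏ k ∈ Ico a (m + 1 + 1), f k = (∏ k ∈ Ico a m, f k) * f m * f (m + 1) := fun f a ha => by
    rw [prod_Ico_succ_top (by omega), top f a ha]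
  unfold cornerSum
  rw [sum_Ico_succ_top hm, sum_Ico_succ_top hm, top' u m le_rfl, top vb m le_rfl,
    top' u 1 hm, top' v 1 hm, top ub 1 hm, top v 1 hm, top vb 1 hm, mul_sum, mul_sum,
    Ico_self, prod_empty, prod_empty]
  have s₁ : ∑ k ∈ Ico 1 m, (∏ j ∈ Ico k (m + 1 + 1), u j) * ((∏ j ∈ Ico 1 m, ub j) * ub m) *
        (∏ j ∈ Ico 1 k, v j) * (1 + v k / vb k) =
      ∑ k ∈ Ico 1 m, u m * u (m + 1) * ub m * ((∏ j ∈ Ico k m, u j) * (∏ j ∈ Ico 1 m, ub j) *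
        (∏ j ∈ Ico 1 k, v j) * (1 + v k / vb k)) :=
    sum_congr rfl fun k hk => by
      rw [top' u k (mem_Ico.1 hk).2.le]; ring
  have s₂ : ∑ k ∈ Ico 1 m, (∏ j ∈ Ico 1 k, ub j) * (1 + ub k / u k) *
        ((∏ j ∈ Ico 1 m, v j) * v m * v (m + 1)) * ∏ j ∈ Ico k (m + 1), vb j =
      ∑ k ∈ Ico 1 m, v m * v (m + 1) * vb m * ((∏ j ∈ Ico 1 k, ub j) * (1 + ub k / u k) *
        (∏ j ∈ Ico 1 m, v j) * ∏ j ∈ Ico k m, vb j) :=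
    sum_congr rfl fun k hk => by
      rw [top vb k (mem_Ico.1 hk).2.le]; ring
  rw [s₁, s₂]
  ring

/-- In `cornerSum_succ` the last coordinates of $x$ and $y$ occur only through the two products in
`pu`, `pv` and the bracket in `h`. -/
theorem cornerSum_eq_of_end {m : ℕ} (hm : 1 ≤ m) {u ub v vb u' ub' v' vb' : ℕ → ℝ}
    (hu : ∀ k < m, u k = u' k) (hub : ∀ k < m, ub k = ub' k)
    (hv : ∀ k < m, v k = v' k) (hvb : ∀ k < m, vb k = vb' k)
    (pu : u m * u (m + 1) * ub m = u' m * u' (m + 1) * ub' m)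
    (pv : v m * v (m + 1) * vb m = v' m * v' (m + 1) * vb' m)
    (h : u m * u (m + 1) * ub m * (1 + v m / vb m)
          + (1 + ub m / u m) * (v m * v (m + 1) * vb m)
          + ub m * (u (m + 1) * (v m * v (m + 1)) + v m) =
        u' m * u' (m + 1) * ub' m * (1 + v' m / vb' m)
          + (1 + ub' m / u' m) * (v' m * v' (m + 1) * vb' m)
          + ub' m * (u' (m + 1) * (v' m * v' (m + 1)) + v' m)) :
    cornerSum (m + 1) u ub v vb = cornerSum (m + 1) u' ub' v' vb' := by
  have P : ∀ {f g : ℕ → ℝ}, (∀ k < m, f k = g k) → ∀ a b, b ≤ m →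
      ∏ k ∈ Ico a b, f k = ∏ k ∈ Ico a b, g k := fun hfg a b hb =>
    prod_congr rfl fun k hk => hfg k ((mem_Ico.1 hk).2.trans_le hb)
  rw [cornerSum_succ hm, cornerSum_succ hm, h, pu, pv, P hu 1 m le_rfl, P hub 1 m le_rfl,
    P hv 1 m le_rfl, P hvb 1 m le_rfl]
  congr 5
  · refine sum_congr rfl fun k hk => ?_
    have hk := (mem_Ico.1 hk).2
    rw [P hu k m le_rfl, P hv 1 k hk.le, hv k hk, hvb k hk]
  · refine sum_congr rfl fun k hk => ?_
    have hk := (mem_Ico.1 hk).2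
    rw [P hub 1 k hk.le, P hvb k m le_rfl, hu k hk, hub k hk]

/-- The part of `cornerSum` not involving the coordinates with the indices `1` and `2`. -/
noncomputable def cornerCore (n : ℕ) (u ub v vb : ℕ → ℝ) : ℝ :=
  (∑ k ∈ Ico 3 n, (∏ j ∈ Ico k (n + 1), u j) * (∏ j ∈ Ico 3 n, ub j) * (∏ j ∈ Ico 3 k, v j) *
      (1 + v k / vb k))
    + (∑ k ∈ Ico 3 n, (∏ j ∈ Ico 3 k, ub j) * (1 + ub k / u k) * (∏ j ∈ Ico 3 (n + 1), v j) *
      ∏ j ∈ Ico k n, vb j)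
    + (∏ j ∈ Ico 3 n, ub j) * (u n * (∏ j ∈ Ico 3 (n + 1), v j) + ∏ j ∈ Ico 3 n, v j)

theorem cornerCore_congr (hn : 3 ≤ n) {u ub v vb u' ub' v' vb' : ℕ → ℝ}
    (hu : ∀ k, 3 ≤ k → u k = u' k) (hub : ∀ k, 3 ≤ k → ub k = ub' k)
    (hv : ∀ k, 3 ≤ k → v k = v' k) (hvb : ∀ k, 3 ≤ k → vb k = vb' k) :
    cornerCore n u ub v vb = cornerCore n u' ub' v' vb' := by
  have P : ∀ {f g : ℕ → ℝ}, (∀ k, 3 ≤ k → f k = g k) → ∀ a b, 3 ≤ a →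
      ∏ k ∈ Ico a b, f k = ∏ k ∈ Ico a b, g k := fun hfg a b ha =>
    prod_congr rfl fun k hk => hfg k (ha.trans (mem_Ico.1 hk).1)
  unfold cornerCore
  rw [P hub 3 n le_rfl, P hv 3 n le_rfl, P hv 3 (n + 1) le_rfl, hu n hn]
  congr 2
  · refine sum_congr rfl fun k hk => ?_
    have hk := (mem_Ico.1 hk).1
    rw [P hu k _ hk, P hv 3 k le_rfl, hv k hk, hvb k hk]
  · refine sum_congr rfl fun k hk => ?_
    have hk := (mem_Ico.1 hk).1
    rw [P hub 3 k le_rfl, P hvb k _ hk, hu k hk, hub k hk]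

theorem prod_Ico_one_eq (f : ℕ → ℝ) {b : ℕ} (hb : 3 ≤ b) :
    ∏ k ∈ Ico 1 b, f k = f 1 * f 2 * ∏ k ∈ Ico 3 b, f k := by
  rw [prod_eq_prod_Ico_succ_bot (by omega) f, prod_eq_prod_Ico_succ_bot (by omega) f, mul_assoc]

/-- This prepares the action of $e_0^c$, which fixes `cornerCore`. The subtracted levels cancel the
$1$ in $1+v_1/\bar v_1$ and in $1+\bar u_1/u_1$, so what remains is the core and one block for each
of $x$ and $y$. -/
theorem cornerSum_eq_core (hn : 3 ≤ n) (u ub v vb : ℕ → ℝ) :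
    cornerSum n u ub v vb = ub 1 * ub 2 * (v 1 * v 2) * cornerCore n u ub v vb
      + u 2 * ub 1 * ub 2 * ((∏ j ∈ Ico 3 (n + 1), u j) * ∏ j ∈ Ico 3 n, ub j) *
        (u 1 * (v 1 / vb 1) + v 1 * (1 + v 2 / vb 2))
      + v 1 * v 2 * vb 2 * ((∏ j ∈ Ico 3 (n + 1), v j) * ∏ j ∈ Ico 3 n, vb j) *
        (ub 1 / u 1 * vb 1 + ub 1 * (1 + ub 2 / u 2)) := by
  have two : ∀ (f : ℕ → ℝ) {b : ℕ}, 3 ≤ b →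
      ∏ k ∈ Ico 2 b, f k = f 2 * ∏ k ∈ Ico 3 b, f k := fun f b hb =>
    prod_eq_prod_Ico_succ_bot (by omega) f
  unfold cornerSum cornerCore
  have s₁ : ∑ k ∈ Ico 3 n, (∏ j ∈ Ico k (n + 1), u j) * (∏ j ∈ Ico 1 n, ub j) *
        (∏ j ∈ Ico 1 k, v j) * (1 + v k / vb k) =
      ub 1 * ub 2 * (v 1 * v 2) * ∑ k ∈ Ico 3 n, (∏ j ∈ Ico k (n + 1), u j) *
        (∏ j ∈ Ico 3 n, ub j) * (∏ j ∈ Ico 3 k, v j) * (1 + v k / vb k) := by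
    rw [mul_sum]
    refine sum_congr rfl fun k hk => ?_
    rw [prod_Ico_one_eq ub hn, prod_Ico_one_eq v (mem_Ico.1 hk).1]; ring
  have s₂ : ∑ k ∈ Ico 3 n, (∏ j ∈ Ico 1 k, ub j) * (1 + ub k / u k) *
        (∏ j ∈ Ico 1 (n + 1), v j) * ∏ j ∈ Ico k n, vb j =
      ub 1 * ub 2 * (v 1 * v 2) * ∑ k ∈ Ico 3 n, (∏ j ∈ Ico 3 k, ub j) * (1 + ub k / u k) *
        (∏ j ∈ Ico 3 (n + 1), v j) * ∏ j ∈ Ico k n, vb j := by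
    rw [mul_sum]
    refine sum_congr rfl fun k hk => ?_
    rw [prod_Ico_one_eq v (by omega), prod_Ico_one_eq ub (mem_Ico.1 hk).1]; ring
  rw [sum_eq_sum_Ico_succ_bot (by omega), sum_eq_sum_Ico_succ_bot (by omega),
    sum_eq_sum_Ico_succ_bot (a := 1) (by omega), sum_eq_sum_Ico_succ_bot (a := 1 + 1) (by omega)]
  norm_num only
  rw [s₁, s₂]
  simp only [two _ hn, two u (b := n + 1) (by omega), prod_Ico_one_eq _ hn,
    prod_Ico_one_eq _ (show 3 ≤ n + 1 by omega), Ico_self, prod_empty,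
    Nat.Ico_succ_singleton, prod_singleton]
  ring

/-! ### The corner entry computed from the matrices. -/

theorem Icc_sub_one_eq_Ico (hn : 1 ≤ n) (a : ℕ) : Icc a (n - 1) = Ico a n := by
  ext k; simp only [mem_Icc, mem_Ico]; omega

theorem Icc_eq_Ico_succ (a : ℕ) : Icc a n = Ico a (n + 1) := by
  ext k; simp only [mem_Icc, mem_Ico]; omega

/-- The range is cut along the symmetry $k\leftrightarrow 2n+1-k$, which exchanges plain and barred
coordinates in $A$. -/
theorem sum_fin_two_mul (hn : 1 ≤ n) (f : ℕ → ℝ) :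
    ∑ k : Fin (2 * n), f (k + 1) =
      ∑ k ∈ Ico 1 n, f k + f n + f (n + 1) + ∑ k ∈ Ico 1 n, f (2 * n + 1 - k) := by
  obtain ⟨m, rfl⟩ := Nat.exists_eq_add_of_le' hn
  rw [Fin.sum_univ_eq_sum_range fun k => f (k + 1),
    show 2 * (m + 1) = m + 1 + 1 + m by ring, sum_range_add, sum_range_succ, sum_range_succ,
    sum_Ico_eq_sum_range, sum_Ico_eq_sum_range, Nat.add_sub_cancel]
  congr 1
  · simp only [add_comm 1]
  · rw [← sum_range_reflect]
    refine sum_congr rfl fun k hk => congrArg f ?_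
    have := mem_range.1 hk
    omega

/-- The summands at $k=1$ and $k=2n$ contain the diagonal entries $y_1/\bar y_1$ and $\bar x_1/x_1$,
without the $1+{}$ of the general pattern. The two products subtracted in `cornerSum`, the levels of
$x$ and $y$, compensate for this. -/
theorem V0_eq_cornerSum (hn : 4 ≤ n) (x y : Coord n) :
    V0 hn (x, y) = cornerSum n x.u x.ub y.u y.ub := by
  have key : V0 hn (x, y) =
      ∑ k : Fin (2 * n), (fun k => entryA x (2 * n) k * entryA y k 1) (k + 1) := by
    simp only [V0, Matrix.mul_apply, matA, Matrix.of_apply, zero_add]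
    rw [show 2 * n - 1 + 1 = 2 * n by omega]
  rw [key, sum_fin_two_mul (by omega) fun k => entryA x (2 * n) k * entryA y k 1]
  have hI := Icc_sub_one_eq_Ico (n := n) (by omega)
  have a₁ : ∑ k ∈ Ico 1 n, entryA x (2 * n) k * entryA y k 1 =
      ∑ k ∈ Ico 1 n, (∏ j ∈ Ico k (n + 1), x.u j) * (∏ j ∈ Ico 1 n, x.ub j) *
        (∏ j ∈ Ico 1 k, y.u j) * (1 + y.u k / y.ub k)
      - (∏ j ∈ Ico 1 (n + 1), x.u j) * ∏ j ∈ Ico 1 n, x.ub j := by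
    rw [sum_eq_sum_Ico_succ_bot (by omega), sum_eq_sum_Ico_succ_bot (a := 1) (b := n) (by omega)
      (fun k => (∏ j ∈ Ico k (n + 1), x.u j) * (∏ j ∈ Ico 1 n, x.ub j) *
        (∏ j ∈ Ico 1 k, y.u j) * (1 + y.u k / y.ub k))]
    have : ∀ k ∈ Ico (1 + 1) n, entryA x (2 * n) k * entryA y k 1 =
        (∏ j ∈ Ico k (n + 1), x.u j) * (∏ j ∈ Ico 1 n, x.ub j) *
        (∏ j ∈ Ico 1 k, y.u j) * (1 + y.u k / y.ub k) := fun k hk => by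
      have := mem_Ico.1 hk
      simp only [entryA]
      rw [if_neg (by omega), if_neg (by omega), if_neg (by omega), if_neg (by omega),
        if_neg (by omega), if_pos (by omega), if_neg (by omega), if_neg (by omega),
        if_pos (by omega), show 2 * n + 1 - 2 * n = 1 by omega, hI, Icc_eq_Ico_succ]
      ring
    rw [sum_congr rfl this]
    simp only [entryA]
    rw [if_neg (by omega), if_neg (by omega), if_neg (by omega), if_neg (by omega),
      if_neg (by omega), if_pos (by omega), if_neg (by omega), if_pos (by trivial),
      if_pos (by omega), show 2 * n + 1 - 2 * n = 1 by omega, hI, Icc_eq_Ico_succ, Ico_self,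
      prod_empty]
    ring
  have a₂ : ∑ k ∈ Ico 1 n, entryA x (2 * n) (2 * n + 1 - k) * entryA y (2 * n + 1 - k) 1 =
      ∑ k ∈ Ico 1 n, (∏ j ∈ Ico 1 k, x.ub j) * (1 + x.ub k / x.u k) *
        (∏ j ∈ Ico 1 (n + 1), y.u j) * (∏ j ∈ Ico k n, y.ub j)
      - (∏ j ∈ Ico 1 (n + 1), y.u j) * ∏ j ∈ Ico 1 n, y.ub j := by
    rw [sum_eq_sum_Ico_succ_bot (by omega), sum_eq_sum_Ico_succ_bot (a := 1) (b := n) (by omega)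
      (fun k => (∏ j ∈ Ico 1 k, x.ub j) * (1 + x.ub k / x.u k) *
        (∏ j ∈ Ico 1 (n + 1), y.u j) * (∏ j ∈ Ico k n, y.ub j))]
    have : ∀ k ∈ Ico (1 + 1) n,
        entryA x (2 * n) (2 * n + 1 - k) * entryA y (2 * n + 1 - k) 1 =
        (∏ j ∈ Ico 1 k, x.ub j) * (1 + x.ub k / x.u k) *
        (∏ j ∈ Ico 1 (n + 1), y.u j) * (∏ j ∈ Ico k n, y.ub j) := fun k hk => by
      have := mem_Ico.1 hk
      simp only [entryA]
      rw [if_neg (by omega), if_neg (by omega), if_neg (by omega), if_neg (by omega),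
        if_neg (by omega), if_neg (by omega), if_neg (by omega), if_neg (by omega),
        if_neg (by omega), if_neg (by omega), if_neg (by omega), if_neg (by omega),
        if_neg (by omega), if_pos (by omega), show 2 * n + 1 - 2 * n = 1 by omega,
        show 2 * n + 1 - (2 * n + 1 - k) = k by omega, hI, Icc_eq_Ico_succ]
      ring
    rw [sum_congr rfl this]
    simp only [entryA]
    rw [if_neg (by omega), if_pos (by omega), if_neg (by omega), if_neg (by omega),
      if_neg (by omega), if_neg (by omega), if_neg (by omega), if_neg (by omega),
      if_neg (by omega), if_neg (by omega), if_pos (by omega),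
      show 2 * n + 1 - 2 * n = 1 by omega,
      show 2 * n + 1 - (2 * n + 1 - 1) = 1 by omega, hI, Icc_eq_Ico_succ, Ico_self, prod_empty]
    ring
  have a₃ : entryA x (2 * n) n * entryA y n 1 =
      (∏ j ∈ Ico 1 n, x.ub j) * (x.u n * ∏ j ∈ Ico 1 (n + 1), y.u j) := by
    simp only [entryA]
    rw [if_neg (by omega), if_neg (by omega), if_neg (by omega), if_neg (by omega),
      if_neg (by omega), if_neg (by omega), if_pos (by trivial), if_neg (by omega),
      if_neg (by omega), if_neg (by omega), if_pos (by trivial),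
      show 2 * n + 1 - 2 * n = 1 by omega, hI, Icc_eq_Ico_succ]
    ring
  have a₄ : entryA x (2 * n) (n + 1) * entryA y (n + 1) 1 =
      (∏ j ∈ Ico 1 n, x.ub j) * (∏ j ∈ Ico 1 n, y.u j) := by
    simp only [entryA]
    rw [if_neg (by omega), if_neg (by omega), if_neg (by omega), if_neg (by omega),
      if_neg (by omega), if_neg (by omega), if_neg (by omega), if_pos (by trivial),
      if_neg (by omega), if_neg (by omega), if_neg (by omega), if_neg (by omega),
      if_pos (by trivial), if_neg (by omega),
      show 2 * n + 1 - 2 * n = 1 by omega, hI]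
  rw [a₁, a₂, a₃, a₄]
  unfold cornerSum
  ring

/-! ### Coordinates of a point and of its image under $e_i^c$. -/

theorem level_eq (hn : 1 ≤ n) (x : Coord n) :
    level x = (∏ k ∈ Ico 1 (n + 1), x.u k) * ∏ k ∈ Ico 1 n, x.ub k := by
  rw [level, Icc_sub_one_eq_Ico hn, Icc_eq_Ico_succ]

theorem Coord.Nonvanishing.u_ne_zero {x : Coord n} (hx : x.Nonvanishing) {i : ℕ} (h₁ : 1 ≤ i)
    (h₂ : i ≤ n) : x.u i ≠ 0 := by
  rw [Coord.u, dif_pos ⟨by omega, h₁⟩]; exact hx.1 _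

theorem Coord.Nonvanishing.ub_ne_zero {x : Coord n} (hx : x.Nonvanishing) {i : ℕ} (h₁ : 1 ≤ i)
    (h₂ : i < n) : x.ub i ≠ 0 := by
  rw [Coord.ub, dif_pos ⟨by omega, h₁⟩]; exact hx.2 _

theorem Coord.u_ofFun (f g : ℕ → ℝ) {i : ℕ} (h₁ : 1 ≤ i) (h₂ : i ≤ n) :
    (Coord.ofFun f g : Coord n).u i = f i := by
  rw [Coord.u, dif_pos ⟨by omega, h₁⟩]
  exact congrArg f (Nat.sub_add_cancel h₁)

theorem Coord.ub_ofFun (f g : ℕ → ℝ) {i : ℕ} (h₁ : 1 ≤ i) (h₂ : i < n) :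
    (Coord.ofFun f g : Coord n).ub i = g i := by
  rw [Coord.ub, dif_pos ⟨by omega, h₁⟩]
  exact congrArg g (Nat.sub_add_cancel h₁)

/-- No bound on $i$ is needed, since out of range both sides take the default value $0$. -/
theorem Coord.u_ofFun_of_eq {f : ℕ → ℝ} (g : ℕ → ℝ) {x : Coord n} {i : ℕ} (h : f i = x.u i) :
    (Coord.ofFun f g : Coord n).u i = x.u i := by
  by_cases hi : 1 ≤ i ∧ i ≤ n
  · rw [u_ofFun f g hi.1 hi.2, h]
  · rw [Coord.u, dif_neg (by omega), Coord.u, dif_neg (by omega)]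

theorem Coord.ub_ofFun_of_eq (f : ℕ → ℝ) {g : ℕ → ℝ} {x : Coord n} {i : ℕ} (h : g i = x.ub i) :
    (Coord.ofFun f g : Coord n).ub i = x.ub i := by
  by_cases hi : 1 ≤ i ∧ i < n
  · rw [ub_ofFun f g hi.1 hi.2, h]
  · rw [Coord.ub, dif_neg (by omega), Coord.ub, dif_neg (by omega)]

theorem e_middle_coords {i : ℕ} (hi : 1 ≤ i) (hin : i ≤ n - 2) (c : ℝ) (x : Coord n) :
    (e i c x).u i = c * (xi (i + 1) c x)⁻¹ * x.u i ∧
    (e i c x).u (i + 1) = c⁻¹ * xi (i + 1) c x * x.u (i + 1) ∧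
    (e i c x).ub i = (xi (i + 1) c x)⁻¹ * x.ub i ∧
    (e i c x).ub (i + 1) = xi (i + 1) c x * x.ub (i + 1) ∧
    (∀ k, k ≠ i → k ≠ i + 1 → (e i c x).u k = x.u k) ∧
    ∀ k, k ≠ i → k ≠ i + 1 → (e i c x).ub k = x.ub k := by
  rw [e, if_neg (by omega), if_neg (by omega), if_neg (by omega)]
  refine ⟨?_, ?_, ?_, ?_, fun k h h' => ?_, fun k h h' => ?_⟩
  · rw [Coord.u_ofFun _ _ hi (by omega), if_pos rfl]
  · rw [Coord.u_ofFun _ _ (by omega) (by omega), if_neg (by omega), if_pos rfl]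
  · rw [Coord.ub_ofFun _ _ hi (by omega), if_pos rfl]
  · rw [Coord.ub_ofFun _ _ (by omega) (by omega), if_neg (by omega), if_pos rfl]
  · exact Coord.u_ofFun_of_eq _ (by rw [if_neg h, if_neg h'])
  · exact Coord.ub_ofFun_of_eq _ (by rw [if_neg h, if_neg h'])

theorem e_zero_coords (hn : 4 ≤ n) (c : ℝ) (x : Coord n) :
    (e 0 c x).u 1 = (xi 2 c x)⁻¹ * x.u 1 ∧
    (e 0 c x).u 2 = c⁻¹ * xi 2 c x * x.u 2 ∧
    (e 0 c x).ub 1 = c * (xi 2 c x)⁻¹ * x.ub 1 ∧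
    (e 0 c x).ub 2 = xi 2 c x * x.ub 2 ∧
    (∀ k, 3 ≤ k → (e 0 c x).u k = x.u k) ∧
    ∀ k, 3 ≤ k → (e 0 c x).ub k = x.ub k := by
  rw [e, if_pos rfl]
  refine ⟨?_, ?_, ?_, ?_, fun k h => ?_, fun k h => ?_⟩
  · rw [Coord.u_ofFun _ _ le_rfl (by omega), if_pos rfl]
  · rw [Coord.u_ofFun _ _ (by omega) (by omega), if_neg (by omega), if_pos rfl]
  · rw [Coord.ub_ofFun _ _ le_rfl (by omega), if_pos rfl]
  · rw [Coord.ub_ofFun _ _ (by omega) (by omega), if_neg (by omega), if_pos rfl]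
  · exact Coord.u_ofFun_of_eq _ (by rw [if_neg (by omega), if_neg (by omega)])
  · exact Coord.ub_ofFun_of_eq _ (by rw [if_neg (by omega), if_neg (by omega)])

theorem e_pred_coords {m : ℕ} (hm : 1 ≤ m) (c : ℝ) (x : Coord (m + 1)) :
    (e m c x).u m = c * x.u m ∧ (e m c x).u (m + 1) = c⁻¹ * x.u (m + 1) ∧
    (∀ k < m, (e m c x).u k = x.u k) ∧ ∀ k, (e m c x).ub k = x.ub k := by
  rw [e, if_neg (by omega), if_neg (by omega), if_pos (by omega), Nat.add_sub_cancel]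
  refine ⟨?_, ?_, fun k h => ?_, fun k => ?_⟩
  · rw [Coord.u_ofFun _ _ hm (by omega), if_pos rfl]
  · rw [Coord.u_ofFun _ _ (by omega) (by omega), if_neg (by omega), if_pos rfl]
  · exact Coord.u_ofFun_of_eq _ (by rw [if_neg (by omega), if_neg (by omega)])
  · exact Coord.ub_ofFun_of_eq _ rfl

theorem e_last_coords {m : ℕ} (hm : 1 ≤ m) (c : ℝ) (x : Coord (m + 1)) :
    (e (m + 1) c x).u m = x.u m ∧ (e (m + 1) c x).u (m + 1) = c * x.u (m + 1) ∧
    (e (m + 1) c x).ub m = c⁻¹ * x.ub m ∧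
    (∀ k < m, (e (m + 1) c x).u k = x.u k) ∧ ∀ k < m, (e (m + 1) c x).ub k = x.ub k := by
  rw [e, if_neg (by omega), if_pos rfl, Nat.add_sub_cancel]
  refine ⟨?_, ?_, ?_, fun k h => ?_, fun k h => ?_⟩
  · exact Coord.u_ofFun_of_eq _ (by rw [if_neg (by omega)])
  · rw [Coord.u_ofFun _ _ (by omega) (by omega), if_pos rfl]
  · rw [Coord.ub_ofFun _ _ hm (by omega), if_pos rfl]
  · exact Coord.u_ofFun_of_eq _ (by rw [if_neg (by omega)])
  · exact Coord.ub_ofFun_of_eq _ (by rw [if_neg (by omega)])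

theorem EPairDefined.ne_zero {i : ℕ} {c : ℝ} {p : Coord n × Coord n} (h : EPairDefined i c p) :
    c * phi i p.1 + eps i p.2 ≠ 0 := by
  have := mul_ne_zero h.1 h.2.2.1
  rwa [mul_add, mul_inv_cancel_left₀ h.1] at this

/-- With $c^{-1}$ cleared, $c_1$ and $c_2$ visibly satisfy $c_1c_2=c$. -/
theorem EPairDefined.c2_eq {i : ℕ} {c : ℝ} {p : Coord n × Coord n} (h : EPairDefined i c p) :
    c2 i c p.1 p.2 = c * (phi i p.1 + eps i p.2) / (c * phi i p.1 + eps i p.2) := by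
  have h₁ := h.ne_zero
  have h₂ := h.2.2.1
  have h₃ := h.1
  rw [c2, div_eq_div_iff h₂ h₁]
  field_simp

/-! ### Scalar identities satisfied by $c_1$, $c_2$ and $\xi$. -/

section Identities

variable {a b c X φ ε c₁ c₂ : ℝ}

/-- Used with $X=x_i$, $a=x_{i+1}$, $b=\bar x_{i+1}$. Clearing denominators leaves a multiple of
$\varphi a=X(a+b)$, the definition of $\varphi_i$; the other identities of this section reduce in
the same way to the definition of $\varphi$ or of $\varepsilon$. -/
theorem middle_identity_left (ha : a ≠ 0) (hab : a + b ≠ 0) (hs : φ + ε ≠ 0)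
    (hd : c * φ + ε ≠ 0) (hφ : φ = X * (b / a + 1)) (h₁ : c₁ = (c * φ + ε) / (φ + ε))
    (h₂ : c₂ = c * (φ + ε) / (c * φ + ε)) :
    X * c₂ + c₁⁻¹ * ((a + c₁ * b) / (a + b)) * ε = X + ε := by
  have e₁ : c₁⁻¹ * ((a + c₁ * b) / (a + b)) = (a * (φ + ε) / (c * φ + ε) + b) / (a + b) := by
    rw [h₁]; field_simp
  have hφ' : φ * a = X * (a + b) := by rw [hφ]; field_simp; ring
  rw [e₁, h₂]
  field_simp
  linear_combination -(c - 1) * ε * hφ'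

theorem middle_identity_right (hb : b ≠ 0) (hab : a + b ≠ 0)
    (hd : c * φ + ε ≠ 0) (hε : ε = X * (a / b + 1)) (h₁ : c₁ = (c * φ + ε) / (φ + ε))
    (h₂ : c₂ = c * (φ + ε) / (c * φ + ε)) :
    c₁⁻¹ * X + (a + c₂ * b) / (a + b) * φ = X + φ := by
  have hε' : ε * b = X * (a + b) := by rw [hε]; field_simp
  rw [h₁, h₂]
  field_simp
  linear_combination (c - 1) * φ * hε'

/-- Used with $X=\bar x_1$, $a=x_2$, $b=\bar x_2$: it expresses $\xi_2$ as $c_1$ plus a correction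
proportional to $c-1$, the source of the extra term in `V0_ePair_zero`. -/
theorem zero_identity_left (ha : a ≠ 0) (hab : a + b ≠ 0) (hs : φ + ε ≠ 0)
    (hφ : φ = X * (b / a + 1)) (h₁ : c₁ = (c * φ + ε) / (φ + ε)) :
    (a + c₁ * b) / (a + b) = c₁ - (c - 1) * X / (φ + ε) := by
  have hφ' : φ * a = X * (a + b) := by rw [hφ]; field_simp; ring
  rw [h₁]
  field_simp
  linear_combination -(c - 1) * hφ'

theorem zero_identity_right (hb : b ≠ 0) (hab : a + b ≠ 0) (hs : φ + ε ≠ 0)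
    (hd : c * φ + ε ≠ 0) (hε : ε = X * (a / b + 1)) (h₁ : c₁ = (c * φ + ε) / (φ + ε))
    (h₂ : c₂ = c * (φ + ε) / (c * φ + ε)) :
    c₁ * ((a + c₂ * b) / (a + b)) = c₁ + (c - 1) * X / (φ + ε) := by
  have hε' : ε * b = X * (a + b) := by rw [hε]; field_simp
  rw [h₁, h₂]
  field_simp
  linear_combination (c - 1) * hε'

end Identities

/-! ### The effect of $e_i^c$ on $V_0$. -/

theorem V0_ePair_middle (hn : 4 ≤ n) {x y : Coord n} (hx : x.Nonvanishing) (hy : y.Nonvanishing)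
    {c : ℝ} {i : ℕ} (hi : 1 ≤ i) (hin : i ≤ n - 2) (h : EPairDefined i c (x, y)) :
    V0 hn (ePair i c (x, y)) = V0 hn (x, y) := by
  have hd := h.ne_zero
  have hc2 := h.c2_eq
  obtain ⟨hc, hs, -, ⟨hc₁, -, hξx⟩, ⟨hc₂, -, hξy⟩⟩ := h
  obtain ⟨hx₁, hx₂⟩ := hξx hi hin
  obtain ⟨hy₁, hy₂⟩ := hξy hi hin
  dsimp only at hd hc2 hs hc₁ hx₁ hx₂ hc₂ hy₁ hy₂
  have hc1 : c1 i c x y = (c * phi i x + eps i y) / (phi i x + eps i y) := rfl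
  rw [ePair, V0_eq_cornerSum, V0_eq_cornerSum]
  dsimp only
  have hφ : phi i x = x.u i * (x.ub (i + 1) / x.u (i + 1) + 1) := by
    rw [phi, if_neg (by omega), if_neg (by omega), if_neg (by omega)]
  have hε : eps i y = y.ub i * (y.u (i + 1) / y.ub (i + 1) + 1) := by
    rw [eps, if_neg (by omega), if_neg (by omega), if_neg (by omega)]
  have x₁ := hx.u_ne_zero hi (by omega)
  have x₂ := hx.u_ne_zero (i := i + 1) (by omega) (by omega)
  have y₁ := hy.ub_ne_zero hi (by omega)
  have y₂ := hy.ub_ne_zero (i := i + 1) (by omega) (by omega)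
  have left := middle_identity_left x₂ hx₁ hs hd hφ hc1 hc2
  have right := middle_identity_right y₂ hy₁ hd hε hc1 hc2
  obtain ⟨ux, ux', bx, bx', kx, kbx⟩ := e_middle_coords hi hin (c1 i c x y) x
  obtain ⟨uy, uy', biy, biy', ky, kby⟩ := e_middle_coords hi hin (c2 i c x y) y
  have hξ : xi (i + 1) (c1 i c x y) x ≠ 0 := div_ne_zero hx₂ hx₁
  have hη : xi (i + 1) (c2 i c x y) y ≠ 0 := div_ne_zero hy₂ hy₁
  have dξ : xi (i + 1) (c1 i c x y) x =
    (x.u (i + 1) + c1 i c x y * x.ub (i + 1)) / (x.u (i + 1) + x.ub (i + 1)) := rfl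
  have dη : xi (i + 1) (c2 i c x y) y =
    (y.u (i + 1) + c2 i c x y * y.ub (i + 1)) / (y.u (i + 1) + y.ub (i + 1)) := rfl
  rw [← dξ] at left
  rw [← dη] at right
  have mξ : xi (i + 1) (c1 i c x y) x * (x.u (i + 1) + x.ub (i + 1)) =
    x.u (i + 1) + c1 i c x y * x.ub (i + 1) := by rw [dξ, div_mul_cancel₀ _ hx₁]
  have mη : xi (i + 1) (c2 i c x y) y * (y.u (i + 1) + y.ub (i + 1)) =
    y.u (i + 1) + c2 i c x y * y.ub (i + 1) := by rw [dη, div_mul_cancel₀ _ hy₁]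
  refine cornerSum_eq_of_middle hi (by omega) kx kbx ky kby ?_ ?_ ?_ ?_ ?_ ?_
  · rw [ux, ux']; field_simp
  · rw [bx, bx']; field_simp
  · rw [uy, uy']; field_simp
  · rw [biy, biy']; field_simp
  · rw [ux, ux', uy, uy', biy, biy']
    rw [hε] at left
    generalize xi (i + 1) (c1 i c x y) x = ξ at *
    generalize xi (i + 1) (c2 i c x y) y = η at *
    generalize c1 i c x y = C₁ at *
    generalize c2 i c x y = C₂ at *
    have e₁ : C₂ * η⁻¹ * y.u i / (η⁻¹ * y.ub i) = C₂ * (y.u i / y.ub i) := by field_simp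
    -- The quantity $y_i(1+y_{i+1}/\bar y_{i+1})$ is invariant by the definition of $\eta$, and `e₄`
    -- below identifies it with $(y_i/\bar y_i)\,\varepsilon_i(y)$. Removing the factor
    -- $x_{i+1}y_i/\bar y_i$ then leaves exactly `left`.
    have e₂ : C₂ * η⁻¹ * y.u i * (1 + C₂⁻¹ * η * y.u (i + 1) / (η * y.ub (i + 1))) =
        y.u i * (1 + y.u (i + 1) / y.ub (i + 1)) := by
      field_simp; linear_combination -y.u i * mη
    rw [mul_assoc _ (C₂ * η⁻¹ * y.u i), e₂, e₁]
    have e₃ : C₁ * ξ⁻¹ * x.u i * (C₁⁻¹ * ξ * x.u (i + 1)) = x.u i * x.u (i + 1) := by field_simp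
    rw [e₃]
    have e₄ : y.u i * (1 + y.u (i + 1) / y.ub (i + 1)) =
        y.u i / y.ub i * (y.ub i * (y.u (i + 1) / y.ub (i + 1) + 1)) := by field_simp; ring
    rw [mul_assoc (x.u (i + 1)) (y.u i), e₄]
    linear_combination x.u (i + 1) * (y.u i / y.ub i) * left
  · rw [ux, ux', bx, bx', biy, biy']
    rw [hφ] at right
    generalize xi (i + 1) (c1 i c x y) x = ξ at *
    generalize xi (i + 1) (c2 i c x y) y = η at *
    generalize c1 i c x y = C₁ at *
    generalize c2 i c x y = C₂ at *
    have e₁ : ξ⁻¹ * x.ub i / (C₁ * ξ⁻¹ * x.u i) = C₁⁻¹ * (x.ub i / x.u i) := by field_simp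
    have e₂ : ξ⁻¹ * x.ub i * (1 + ξ * x.ub (i + 1) / (C₁⁻¹ * ξ * x.u (i + 1))) =
        x.ub i * (1 + x.ub (i + 1) / x.u (i + 1)) := by
      field_simp; linear_combination -x.ub i * mξ
    have e₃ : η⁻¹ * y.ub i * (η * y.ub (i + 1)) = y.ub i * y.ub (i + 1) := by field_simp
    have e₄ : x.ub i * (1 + x.ub (i + 1) / x.u (i + 1)) =
        x.ub i / x.u i * (x.u i * (x.ub (i + 1) / x.u (i + 1) + 1)) := by field_simp; ring
    rw [e₁, e₂, e₃, e₄]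
    linear_combination y.ub (i + 1) * (x.ub i / x.u i) * right

theorem V0_ePair_pred {m : ℕ} (hn : 4 ≤ m + 1) {x y : Coord (m + 1)} (hx : x.Nonvanishing)
    (hy : y.Nonvanishing) {c : ℝ} (h : EPairDefined m c (x, y)) :
    V0 hn (ePair m c (x, y)) = V0 hn (x, y) := by
  have hd := h.ne_zero
  have hc2 := h.c2_eq
  obtain ⟨hc, hs, -, ⟨hc₁, -⟩, ⟨hc₂, -⟩⟩ := h
  dsimp only at hd hc2 hs hc₁ hc₂
  have hc1 : c1 m c x y = (c * phi m x + eps m y) / (phi m x + eps m y) := rfl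
  rw [ePair, V0_eq_cornerSum, V0_eq_cornerSum]
  dsimp only
  have hφ : phi m x = x.u m := by
    rw [phi, if_neg (by omega), if_neg (by omega), if_pos (by omega), Nat.add_sub_cancel]
  have hε : eps m y = y.u (m + 1) * y.ub m := by
    rw [eps, if_neg (by omega), if_neg (by omega), if_pos (by omega), Nat.add_sub_cancel]
  have x₁ := hx.u_ne_zero (i := m) (by omega) (by omega)
  have y₁ := hy.ub_ne_zero (i := m) (by omega) (by omega)
  obtain ⟨ux, ux', kx, kbx⟩ := e_pred_coords (by omega) (c1 m c x y) x
  obtain ⟨uy, uy', ky, kby⟩ := e_pred_coords (by omega) (c2 m c x y) y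
  refine cornerSum_eq_of_end (by omega) kx (fun k _ => kbx k) ky (fun k _ => kby k) ?_ ?_ ?_
  · rw [ux, ux', kbx]; field_simp
  · rw [uy, uy', kby]; field_simp
  · rw [ux, ux', kbx, uy, uy', kby]
    rw [hφ, hε] at hc1 hc2 hd hs
    rw [hc1, hc2]
    field_simp
    ring

theorem V0_ePair_last {m : ℕ} (hn : 4 ≤ m + 1) {x y : Coord (m + 1)} (hx : x.Nonvanishing)
    (hy : y.Nonvanishing) {c : ℝ} (h : EPairDefined (m + 1) c (x, y)) :
    V0 hn (ePair (m + 1) c (x, y)) = V0 hn (x, y) := by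
  have hd := h.ne_zero
  have hc2 := h.c2_eq
  obtain ⟨hc, hs, -, ⟨hc₁, -⟩, ⟨hc₂, -⟩⟩ := h
  dsimp only at hd hc2 hs hc₁ hc₂
  have hc1 : c1 (m + 1) c x y = (c * phi (m + 1) x + eps (m + 1) y) /
    (phi (m + 1) x + eps (m + 1) y) := rfl
  rw [ePair, V0_eq_cornerSum, V0_eq_cornerSum]
  dsimp only
  have hφ : phi (m + 1) x = x.u m * x.u (m + 1) := by
    rw [phi, if_neg (by omega), if_pos rfl, Nat.add_sub_cancel]
  have hε : eps (m + 1) y = y.ub m := by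
    rw [eps, if_neg (by omega), if_pos rfl, Nat.add_sub_cancel]
  have x₁ := hx.u_ne_zero (i := m) (by omega) (by omega)
  have y₁ := hy.ub_ne_zero (i := m) (by omega) (by omega)
  obtain ⟨ux, ux', bx, kx, kbx⟩ := e_last_coords (by omega) (c1 (m + 1) c x y) x
  obtain ⟨uy, uy', biy, ky, kby⟩ := e_last_coords (by omega) (c2 (m + 1) c x y) y
  refine cornerSum_eq_of_end (by omega) kx kbx ky kby ?_ ?_ ?_
  · rw [ux, ux', bx]; field_simp
  · rw [uy, uy', biy]; field_simp
  · rw [ux, ux', bx, uy, uy', biy]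
    rw [hφ, hε] at hc1 hc2 hd hs
    rw [hc1, hc2]
    have hd' : x.u m * c * x.u (m + 1) + y.ub m ≠ 0 := by convert hd using 2; ring
    field_simp
    ring

/-- The transformation of `V0` under `e_0^c`, before the tropical `R` is brought in. -/
theorem V0_ePair_zero (hn : 4 ≤ n) {x y : Coord n} (hx : x.Nonvanishing) (hy : y.Nonvanishing)
    {c : ℝ} (h : EPairDefined 0 c (x, y)) :
    V0 hn (ePair 0 c (x, y)) =
      (V0 hn (x, y) * c1 0 c x y +
        (c - 1) * (level y - level x) *
          (phi 0 x * (y.u 1 / y.ub 1) + x.ub 1 / x.u 1 * eps 0 y) /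
            (phi 0 x + eps 0 y)) / c2 0 c x y := by
  have hd := h.ne_zero
  have hc2 := h.c2_eq
  obtain ⟨hc, hs, -, ⟨hc₁, hξx, -⟩, ⟨hc₂, hξy, -⟩⟩ := h
  obtain ⟨hx₁, hx₂⟩ := hξx rfl
  obtain ⟨hy₁, hy₂⟩ := hξy rfl
  dsimp only at hd hc2 hs hc₁ hx₁ hx₂ hc₂ hy₁ hy₂
  have hc1 : c1 0 c x y = (c * phi 0 x + eps 0 y) / (phi 0 x + eps 0 y) := rfl
  rw [ePair, V0_eq_cornerSum, V0_eq_cornerSum, level_eq (by omega), level_eq (by omega),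
    cornerSum_eq_core (by omega), cornerSum_eq_core (by omega)]
  dsimp only
  have hφ : phi 0 x = x.ub 1 * (x.ub 2 / x.u 2 + 1) := by rw [phi, if_pos rfl]
  have hε : eps 0 y = y.u 1 * (y.u 2 / y.ub 2 + 1) := by rw [eps, if_pos rfl]
  have x₁ := hx.u_ne_zero le_rfl (by omega)
  have x₂ := hx.u_ne_zero (i := 2) (by omega) (by omega)
  have x₃ := hx.ub_ne_zero (i := 1) (by omega) (by omega)
  have y₁ := hy.ub_ne_zero le_rfl (by omega)
  have y₂ := hy.ub_ne_zero (i := 2) (by omega) (by omega)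
  have y₃ := hy.u_ne_zero (i := 1) (by omega) (by omega)
  have left : xi 2 (c1 0 c x y) x = _ := zero_identity_left x₂ hx₁ hs hφ hc1
  have right : c1 0 c x y * xi 2 (c2 0 c x y) y = _ :=
    zero_identity_right y₂ hy₁ hs hd hε hc1 hc2
  obtain ⟨ux, ux', bx, bx', kx, kbx⟩ := e_zero_coords hn (c1 0 c x y) x
  obtain ⟨uy, uy', biy, biy', ky, kby⟩ := e_zero_coords hn (c2 0 c x y) y
  have hξ : xi 2 (c1 0 c x y) x ≠ 0 := div_ne_zero hx₂ hx₁
  have hη : xi 2 (c2 0 c x y) y ≠ 0 := div_ne_zero hy₂ hy₁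
  have mξ : xi 2 (c1 0 c x y) x * (x.u 2 + x.ub 2) = x.u 2 + c1 0 c x y * x.ub 2 := by
    rw [xi, div_mul_cancel₀ _ hx₁]
  have mη : xi 2 (c2 0 c x y) y * (y.u 2 + y.ub 2) = y.u 2 + c2 0 c x y * y.ub 2 := by
    rw [xi, div_mul_cancel₀ _ hy₁]
  have P : ∀ {f g : ℕ → ℝ} (b : ℕ), (∀ k, 3 ≤ k → f k = g k) →
      ∏ k ∈ Ico 3 b, f k = ∏ k ∈ Ico 3 b, g k := fun b hfg =>
    prod_congr rfl fun k hk => hfg k (mem_Ico.1 hk).1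
  rw [cornerCore_congr (by omega) kx kbx ky kby, P _ kx, P _ kbx, P _ ky, P _ kby,
    ux, ux', bx, bx', uy, uy', biy, biy', prod_Ico_one_eq x.u (by omega),
    prod_Ico_one_eq x.ub (by omega), prod_Ico_one_eq y.u (by omega),
    prod_Ico_one_eq y.ub (by omega)]
  generalize cornerCore n x.u x.ub y.u y.ub = W
  generalize ∏ k ∈ Ico 3 (n + 1), x.u k = Lx
  generalize ∏ k ∈ Ico 3 n, x.ub k = Lx'
  generalize ∏ k ∈ Ico 3 (n + 1), y.u k = Ly
  generalize ∏ k ∈ Ico 3 n, y.ub k = Ly'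
  have hcc : c1 0 c x y * c2 0 c x y = c := by rw [hc1, hc2]; field_simp
  have pε : y.u 1 * (1 + y.u 2 / y.ub 2) = eps 0 y := by rw [hε]; ring
  have pφ : x.ub 1 * (1 + x.ub 2 / x.u 2) = phi 0 x := by rw [hφ]; ring
  generalize phi 0 x = φ at *
  generalize eps 0 y = ε at *
  generalize xi 2 (c1 0 c x y) x = ξ at *
  generalize xi 2 (c2 0 c x y) y = η at *
  generalize c1 0 c x y = C₁ at *
  generalize c2 0 c x y = C₂ at *
  -- By `q₁` and `q₂` the coefficient of the core $W$ is multiplied by $C_1C_2^{-1}$. The blocks of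
  -- $x$ and $y$ acquire the same factor up to corrections, which `q₇` and `q₈` compute; with their
  -- prefactors these carry $-\ell(x)$ and $\ell(y)$.
  have q₁ : C₁ * ξ⁻¹ * x.ub 1 * (ξ * x.ub 2) = C₁ * (x.ub 1 * x.ub 2) := by field_simp
  have q₂ : η⁻¹ * y.u 1 * (C₂⁻¹ * η * y.u 2) = C₂⁻¹ * (y.u 1 * y.u 2) := by field_simp
  have q₃ : C₁⁻¹ * ξ * x.u 2 * (C₁ * ξ⁻¹ * x.ub 1) * (ξ * x.ub 2) =
    ξ * (x.u 2 * x.ub 1 * x.ub 2) := by field_simp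
  have q₄ : C₂⁻¹ * (y.u 1 * y.u 2) * (η * y.ub 2) = C₂⁻¹ * η * (y.u 1 * y.u 2 * y.ub 2) := by ring
  have q₅ : η⁻¹ * y.u 1 * (1 + C₂⁻¹ * η * y.u 2 / (η * y.ub 2)) = (C₂ * η)⁻¹ * (η * ε) := by
    rw [← pε]; field_simp; linear_combination -mη
  have q₆ : C₁ * ξ⁻¹ * x.ub 1 * (1 + ξ * x.ub 2 / (C₁⁻¹ * ξ * x.u 2)) = C₁ * φ := by
    rw [← pφ]; field_simp; linear_combination -mξ
  have q₇ : ξ * (ξ⁻¹ * x.u 1 * (η⁻¹ * y.u 1 / (C₂ * η⁻¹ * y.ub 1)) + (C₂ * η)⁻¹ * (η * ε)) =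
      C₂⁻¹ * ((x.u 1 * (y.u 1 / y.ub 1) + ε) * C₁ -
        (c - 1) * x.u 1 * (φ * (y.u 1 / y.ub 1) + x.ub 1 / x.u 1 * ε) / (φ + ε)) := by
    have : ξ * (ξ⁻¹ * x.u 1 * (η⁻¹ * y.u 1 / (C₂ * η⁻¹ * y.ub 1)) + (C₂ * η)⁻¹ * (η * ε)) =
        C₂⁻¹ * (x.u 1 * (y.u 1 / y.ub 1) + ξ * ε) := by field_simp
    rw [this, left, hc1]
    congr 1
    field_simp
    ring
  have q₈ : η * (C₁ * ξ⁻¹ * x.ub 1 / (ξ⁻¹ * x.u 1) * (C₂ * η⁻¹ * y.ub 1) + C₁ * φ) =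
      (x.ub 1 / x.u 1 * y.ub 1 + φ) * C₁ +
        (c - 1) * y.ub 1 * (φ * (y.u 1 / y.ub 1) + x.ub 1 / x.u 1 * ε) / (φ + ε) := by
    have : η * (C₁ * ξ⁻¹ * x.ub 1 / (ξ⁻¹ * x.u 1) * (C₂ * η⁻¹ * y.ub 1) + C₁ * φ) =
        C₁ * C₂ * (x.ub 1 / x.u 1) * y.ub 1 + C₁ * η * φ := by field_simp
    rw [this, hcc, right, hc1]
    field_simp
    ring
  rw [q₁, q₂, q₃, q₄, q₅, q₆, pε, pφ, div_eq_inv_mul _ C₂]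
  linear_combination (x.u 2 * x.ub 1 * x.ub 2 * (Lx * Lx')) * q₇ +
    C₂⁻¹ * (y.u 1 * y.u 2 * y.ub 2) * (Ly * Ly') * q₈

/-! ### Entries of the coefficients of $M(x,z)M(y,z)$. -/

theorem entryA_of_lt (x : Coord n) {i j : ℕ} (h : i < j) : entryA x i j = 0 := if_pos h

theorem entryA_diag (x : Coord n) {i : ℕ} (h : i ≤ n - 1) :
    entryA x i i = x.u i / x.ub i := by
  rw [entryA, if_neg (lt_irrefl i), if_pos rfl, if_pos h]

theorem entryA_two_one (hn : 4 ≤ n) (x : Coord n) :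
    entryA x 2 1 = x.u 1 * (1 + x.u 2 / x.ub 2) := by
  rw [entryA, if_neg (by omega), if_neg (by omega), if_pos (by omega)]
  simp

theorem entryA_last_one (hn : 4 ≤ n) (x : Coord n) : entryA x (2 * n) 1 = level x := by
  simp only [entryA]
  rw [if_neg (by omega), if_neg (by omega), if_neg (by omega), if_neg (by omega),
    if_neg (by omega), if_pos (by omega), show 2 * n + 1 - 2 * n = 1 by omega, level]

theorem entryA_last_last (hn : 4 ≤ n) (x : Coord n) :
    entryA x (2 * n) (2 * n) = x.ub 1 / x.u 1 := by
  rw [entryA, if_neg (by omega), if_pos rfl, if_neg (by omega), if_neg (by omega),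
    if_neg (by omega), show 2 * n + 1 - 2 * n = 1 by omega]

theorem matB_apply (x : Coord n) (i j : Fin (2 * n)) :
    matB x i j = entryA x (i + 1) 1 * entryA x (2 * n) (j + 1) - level x * entryA x (i + 1) (j + 1)
      - (level x)⁻¹ * matC x i j := by
  simp [matB, matA, Matrix.mul_apply, Matrix.diagonal_apply]

/-- Comparison of the constant and the linear coefficients in `z`. -/
theorem matM_coeff {x y x' y' : Coord n}
    (h : ∀ z : ℝ, matM x z * matM y z = matM x' z * matM y' z) :
    matA x * matA y = matA x' * matA y' ∧
      matA x * matB y + matB x * matA y = matA x' * matB y' + matB x' * matA y' := by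
  have expand : ∀ (p q : Coord n) (z : ℝ), matM p z * matM q z = matA p * matA q +
      z • (matA p * matB q + matB p * matA q) +
      z ^ 2 • (matA p * matC q + matB p * matB q + matC p * matA q) +
      z ^ 3 • (matB p * matC q + matC p * matB q) + z ^ 4 • (matC p * matC q) := by
    intro p q z
    simp only [matM, add_mul, mul_add, Matrix.smul_mul, Matrix.mul_smul, smul_smul, smul_add]
    module
  simp only [expand] at h
  generalize matA x * matA y = a₀ at h ⊢
  generalize matA x' * matA y' = b₀ at h ⊢
  generalize matA x * matB y + matB x * matA y = a₁ at h ⊢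
  generalize matA x' * matB y' + matB x' * matA y' = b₁ at h ⊢
  have entry : ∀ i j z, _ := fun i j z => congrFun (congrFun (h z) i) j
  simp only [Matrix.add_apply, Matrix.smul_apply, smul_eq_mul] at entry
  constructor <;> ext i j
  · linear_combination entry i j 0
  -- The weights are those of the central five-point formula for the derivative at $0$, which is
  -- exact in degree at most $4$.
  · linear_combination (2 / 3) * entry i j 1 - (2 / 3) * entry i j (-1)
      - (1 / 12) * entry i j 2 + (1 / 12) * entry i j (-2)

section Entries

variable (hn : 4 ≤ n) (x y : Coord n)

theorem matA_mul_one_one :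
    (matA x * matA y) ⟨0, by omega⟩ ⟨0, by omega⟩ =
      x.u 1 / x.ub 1 * (y.u 1 / y.ub 1) := by
  rw [Matrix.mul_apply, sum_eq_single ⟨0, by omega⟩]
  · simp only [matA, Matrix.of_apply, zero_add]
    rw [entryA_diag x (by omega), entryA_diag y (by omega)]
  · intro k _ hk
    have : (k : ℕ) ≠ 0 := fun h => hk (Fin.ext h)
    simp only [matA, Matrix.of_apply]
    rw [entryA_of_lt x (by omega), zero_mul]
  · simp

theorem matA_mul_two_one :
    (matA x * matA y) ⟨1, by omega⟩ ⟨0, by omega⟩ =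
      eps 0 x * (y.u 1 / y.ub 1) + x.u 2 / x.ub 2 * eps 0 y := by
  rw [Matrix.mul_apply, Fintype.sum_eq_add ⟨0, by omega⟩ ⟨1, by omega⟩ (Fin.ne_of_val_ne zero_ne_one)]
  · simp only [matA, Matrix.of_apply, zero_add, Nat.reduceAdd]
    rw [entryA_diag y (by omega), entryA_diag x (by omega), entryA_two_one hn, entryA_two_one hn,
      eps, eps, if_pos rfl, if_pos rfl]
    ring
  · intro k hk
    have h₀ : (k : ℕ) ≠ 0 := fun h => hk.1 (Fin.ext h)
    have h₁ : (k : ℕ) ≠ 1 := fun h => hk.2 (Fin.ext h)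
    simp only [matA, Matrix.of_apply]
    rw [entryA_of_lt x (by omega), zero_mul]

/-- Since $A_{2n,1}=\ell$, the rank-one part of $B$ cancels $\ell A$ in this column. -/
theorem matB_first_col (i : Fin (2 * n)) : matB y i ⟨0, by omega⟩ = 0 := by
  have hC : matC y i ⟨0, by omega⟩ = 0 := by
    simp only [matC, Matrix.of_apply]
    exact if_neg (by omega)
  rw [matB_apply, hC]
  simp only [zero_add]
  rw [entryA_last_one hn]
  ring

theorem matB_second_row (j : Fin (2 * n)) : matB x ⟨1, by omega⟩ j =
    eps 0 x * entryA x (2 * n) (j + 1) - level x * entryA x 2 (j + 1) := by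
  have hC : matC x ⟨1, by omega⟩ j = 0 := by
    simp only [matC, Matrix.of_apply]
    exact if_neg (by omega)
  rw [matB_apply, hC]
  simp only [Nat.reduceAdd]
  rw [entryA_two_one hn, eps, if_pos rfl]
  ring

/-- The first column of $B(y)$ vanishes, and the second row of $B(x)$ combines the last and second
rows of $A(x)$; the last row produces $V_0$. -/
theorem matAB_two_one :
    (matA x * matB y + matB x * matA y) ⟨1, by omega⟩ ⟨0, by omega⟩ =
      eps 0 x * V0 hn (x, y) - level x * (matA x * matA y) ⟨1, by omega⟩ ⟨0, by omega⟩ := by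
  rw [Matrix.add_apply, V0, Matrix.mul_apply, Matrix.mul_apply, Matrix.mul_apply,
    Matrix.mul_apply, sum_eq_zero fun k _ => by rw [matB_first_col hn, mul_zero], zero_add,
    mul_sum, mul_sum, ← sum_sub_distrib]
  refine sum_congr rfl fun k _ => ?_
  rw [matB_second_row hn]
  simp only [matA, Matrix.of_apply, Nat.reduceAdd]
  rw [show 2 * n - 1 + 1 = 2 * n by omega]
  ring

/-- Here $A_{1,1}A_{2n,2n}=1$ is cancelled by the term $\ell^{-1}C$. -/
theorem matB_one_last (hx : x.Nonvanishing) :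
    matB x ⟨0, by omega⟩ ⟨2 * n - 1, by omega⟩ = 0 := by
  have hl : level x ≠ 0 := by
    rw [level_eq (by omega)]
    exact mul_ne_zero
      (prod_ne_zero_iff.2 fun k hk => hx.u_ne_zero (mem_Ico.1 hk).1 (by
        have := (mem_Ico.1 hk).2; omega))
      (prod_ne_zero_iff.2 fun k hk => hx.ub_ne_zero (mem_Ico.1 hk).1 (mem_Ico.1 hk).2)
  have hC : matC x ⟨0, by omega⟩ ⟨2 * n - 1, by omega⟩ = level x := by
    simp only [matC, Matrix.of_apply]
    exact if_pos ⟨trivial, by omega⟩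
  rw [matB_apply, hC]
  simp only [zero_add]
  have := hx.u_ne_zero le_rfl (by omega)
  have := hx.ub_ne_zero le_rfl (by omega)
  rw [show 2 * n - 1 + 1 = 2 * n by omega, entryA_diag x (by omega), entryA_last_last hn,
    entryA_of_lt x (by omega)]
  field_simp
  ring

/-- The factor on the left is $(A(x)A(y))_{1,1}$, itself preserved by $R$; so the right-hand side
takes the same value at $(x,y)$ and at $R(x,y)$. -/
theorem matAB_two_last (hx : x.Nonvanishing) (hy : y.Nonvanishing) :
    (matA x * matB y + matB x * matA y) ⟨1, by omega⟩ ⟨2 * n - 1, by omega⟩ *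
        (x.u 1 / x.ub 1 * (y.u 1 / y.ub 1)) =
      x.u 1 * x.u 2 / (x.ub 1 * x.ub 2) * (phi 0 x + eps 0 y) := by
  have row : ∀ p : Coord n, matB p ⟨1, by omega⟩ ⟨2 * n - 1, by omega⟩ =
      eps 0 p * (p.ub 1 / p.u 1) := fun p => by
    rw [matB_second_row hn]
    simp only
    rw [show 2 * n - 1 + 1 = 2 * n by omega, entryA_last_last hn, entryA_of_lt p (by omega)]
    ring
  rw [Matrix.add_apply, Matrix.mul_apply, Matrix.mul_apply,
    Fintype.sum_eq_add ⟨0, by omega⟩ ⟨1, by omega⟩ (Fin.ne_of_val_ne zero_ne_one),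
    sum_eq_single ⟨2 * n - 1, by omega⟩, matB_one_last hn y hy, row, row]
  · simp only [matA, Matrix.of_apply, Nat.reduceAdd]
    rw [show 2 * n - 1 + 1 = 2 * n by omega, entryA_diag x (by omega), entryA_last_last hn,
      phi, if_pos rfl, eps, if_pos rfl, eps, if_pos rfl]
    have := hx.u_ne_zero (i := 1) le_rfl (by omega)
    have := hx.ub_ne_zero (i := 1) le_rfl (by omega)
    have := hx.u_ne_zero (i := 2) (by omega) (by omega)
    have := hx.ub_ne_zero (i := 2) (by omega) (by omega)
    have := hy.u_ne_zero (i := 1) le_rfl (by omega)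
    have := hy.ub_ne_zero (i := 1) le_rfl (by omega)
    have := hy.ub_ne_zero (i := 2) (by omega) (by omega)
    field_simp
    ring
  · intro k _ hk
    have h : (k : ℕ) ≠ 2 * n - 1 := fun h => hk (Fin.ext h)
    simp only [matA, Matrix.of_apply]
    rw [entryA_of_lt y (by omega), mul_zero]
  · simp
  · intro k hk
    have h₀ : (k : ℕ) ≠ 0 := fun h => hk.1 (Fin.ext h)
    have h₁ : (k : ℕ) ≠ 1 := fun h => hk.2 (Fin.ext h)
    simp only [matA, Matrix.of_apply]
    rw [entryA_of_lt x (by omega), zero_mul]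

end Entries

/-! ### The relation imposed by the tropical $R$, and the conclusion. -/

/-- The ratio `φ₀(x') / (φ₀(x') + ε₀(y'))` in terms of `(x, y)`, where `(x', y') = R(x, y)`. -/
theorem IsTropicalR.V0_mul_phi_zero (hn : 4 ≤ n) {x y x' y' : Coord n} (hx : x.Nonvanishing)
    (hy : y.Nonvanishing) (hR : IsTropicalR (x, y) (x', y')) :
    V0 hn (x, y) * phi 0 x' * (phi 0 x + eps 0 y) =
      (phi 0 x' + eps 0 y') * (V0 hn (x, y) * phi 0 x +
        (level y - level x) * (phi 0 x * (y.u 1 / y.ub 1) + x.ub 1 / x.u 1 * eps 0 y)) := by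
  obtain ⟨hx', hy', -, -, hl, hM⟩ := hR
  dsimp only at hx' hy' hl hM
  obtain ⟨h₀, h₁⟩ := matM_coeff hM
  have hV : V0 hn (x', y') = V0 hn (x, y) := congrFun (congrFun h₀.symm _) _
  have h₁₁ := congrFun (congrFun h₀ ⟨0, by omega⟩) ⟨0, by omega⟩
  have hlast := congrFun (congrFun h₁ ⟨1, by omega⟩) ⟨2 * n - 1, by omega⟩
  have htwo := congrFun (congrFun h₁ ⟨1, by omega⟩) ⟨0, by omega⟩
  -- Both sides now contain the same $V_0$ and the same $(A(x)A(y))_{2,1}$; $\ell(x')=\ell(y)$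
  -- brings in the difference of levels.
  rw [matAB_two_one hn, matAB_two_one hn, ← h₀, matA_mul_two_one hn, hV, ← hl] at htwo
  rw [matA_mul_one_one hn, matA_mul_one_one hn] at h₁₁
  have E := matAB_two_last hn x y hx hy
  rw [hlast, h₁₁, matAB_two_last hn x' y' hx' hy'] at E
  have eps_eq : ∀ p : Coord n, p.Nonvanishing →
      eps 0 p = p.u 1 * p.u 2 / (p.ub 1 * p.ub 2) * phi 0 p := fun p hp => by
    have := hp.ub_ne_zero (i := 1) le_rfl (by omega)
    have := hp.u_ne_zero (i := 2) (by omega) (by omega)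
    have := hp.ub_ne_zero (i := 2) (by omega) (by omega)
    rw [eps, if_pos rfl, phi, if_pos rfl]
    field_simp
    ring
  rw [eps_eq x hx, eps_eq x' hx'] at htwo
  have u₁ := hx.u_ne_zero (i := 1) le_rfl (by omega)
  have u₂ := hx.u_ne_zero (i := 2) (by omega) (by omega)
  have b₁ := hx.ub_ne_zero (i := 1) le_rfl (by omega)
  have b₂ := hx.ub_ne_zero (i := 2) (by omega) (by omega)
  have hX : x.u 2 / x.ub 2 = x.u 1 * x.u 2 / (x.ub 1 * x.ub 2) * (x.ub 1 / x.u 1) := by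
    field_simp
  rw [hX] at htwo
  have ht : x.u 1 * x.u 2 / (x.ub 1 * x.ub 2) ≠ 0 :=
    div_ne_zero (mul_ne_zero u₁ u₂) (mul_ne_zero b₁ b₂)
  generalize x.u 1 * x.u 2 / (x.ub 1 * x.ub 2) = t at *
  generalize x'.u 1 * x'.u 2 / (x'.ub 1 * x'.ub 2) = t' at *
  apply mul_left_cancel₀ ht
  -- `E` says $t'(\varphi_0(x')+\varepsilon_0(y'))=t(\varphi_0(x)+\varepsilon_0(y))$, and `htwo`
  -- expresses $V_0\,t'\varphi_0(x')$ through $x$ and $y$; this combination eliminates $t'$.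
  linear_combination (-V0 hn (x, y) * phi 0 x') * E - (phi 0 x' + eps 0 y') * htwo

end GeomD

theorem mainTheorem12 (n : ℕ) (hn : 4 ≤ n) (x y : GeomD.Coord n)
    (hx : x.Nonvanishing) (hy : y.Nonvanishing) (c : ℝ) :
    (∀ i : ℕ, 1 ≤ i → i ≤ n → GeomD.EPairDefined i c (x, y) →
      GeomD.V0 hn (GeomD.ePair i c (x, y)) = GeomD.V0 hn (x, y)) ∧
    (GeomD.EPairDefined 0 c (x, y) →
      ∀ x' y' : GeomD.Coord n, GeomD.IsTropicalR (x, y) (x', y') →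
        GeomD.phi 0 x' + GeomD.eps 0 y' ≠ 0 →
        GeomD.V0 hn (GeomD.ePair 0 c (x, y)) =
          GeomD.V0 hn (x, y) *
            ((c * GeomD.phi 0 x' + GeomD.eps 0 y') / (GeomD.phi 0 x' + GeomD.eps 0 y') *
              ((c * GeomD.phi 0 x + GeomD.eps 0 y) /
                (c * GeomD.phi 0 x + c * GeomD.eps 0 y)))) := by
  refine ⟨fun i hi hin h => ?_, fun h x' y' hR hs' => ?_⟩
  · rcases lt_or_ge (n - 2) i with hi' | hi'
    -- Writing $n=m+1$ removes the truncated subtraction $n-1$ from the formulas for the last two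
    -- indices.
    · obtain ⟨m, rfl⟩ := Nat.exists_eq_add_of_le' (show 1 ≤ n by omega)
      obtain rfl | rfl : i = m ∨ i = m + 1 := by omega
      · exact GeomD.V0_ePair_pred hn hx hy h
      · exact GeomD.V0_ePair_last hn hx hy h
    · exact GeomD.V0_ePair_middle hn hx hy hi hi' h
  · have key := hR.V0_mul_phi_zero hn hx hy
    have hd := h.ne_zero
    have hc2 := h.c2_eq
    have hc := h.1
    have hs := h.2.1
    rw [GeomD.V0_ePair_zero hn hx hy h]
    dsimp only at hd hc2 hs
    rw [hc2, GeomD.c1, ← mul_add]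
    generalize GeomD.V0 hn (x, y) = V at *
    generalize GeomD.phi 0 x * (y.u 1 / y.ub 1) + x.ub 1 / x.u 1 * GeomD.eps 0 y = G at *
    generalize GeomD.phi 0 x = φ at *
    generalize GeomD.eps 0 y = ε at *
    generalize GeomD.phi 0 x' = φ' at *
    generalize GeomD.eps 0 y' = ε' at *
    generalize GeomD.level y - GeomD.level x = l at *
    -- Each quotient $(c\varphi+\varepsilon)/(\varphi+\varepsilon)$ equals
    -- $1+(c-1)\varphi/(\varphi+\varepsilon)$, so the claim is $c-1$ times `key` divided by both
    -- denominators.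
    have : V * ((c * φ + ε) / (φ + ε)) + (c - 1) * l * G / (φ + ε) =
        V * ((c * φ' + ε') / (φ' + ε')) := by
      field_simp
      linear_combination (1 - c) * key
    rw [this]
    field_simp
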